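/- \textbf{Lemma (weak distributed expansion of the tensor graph).} \emph{Definitions.} Write $[n]=\{1,\dots,n\}$. A set $\Omega\subseteq[p]\times[p]$ is \emph{$d$-distributed} if it contains the diagonal $\{(i,i):i\in[p]\}$ and meets every row $\{k\}\times[p]$ and every column $[p]\times\{k\}$ in at most $d$ points. A \emph{uniformly random $\delta$-left-regular bipartite graph} $G=([p],[m],E)$ is obtained by drawing, for each $i\in[p]$, $\delta$ vertices $j_1,\dots,j_\delta\in[m]$ uniformly and independently (with replacement; all draws for all $i$ are independent) and joining $i$ to $j_1,\dots,j_\delta$. For bipartite graphs $G_1=([p],[m],E_1)$ and $G_2=([p],[m],E_2)$, the \emph{tensor graph} $G_1\otimes G_2$ is the bipartite graph from $[p]\times[p]$ to $[m]\times[m]$ in which $(i,i')$ is adjacent to $(j,j')$ iff $\{i,j\}\in E_1$ and $\{i',j'\}\in E_2$. For a set $S$ of left vertices, $N(S)$ is the set (counted without multiplicity) of right vertices adjacent to some element of $S$, and $N(i,i')=N(\{(i,i')\})$. \emph{Statement.} There are $\epsilon\in(0,\tfrac14)$ and $c>0$ such that for all constants $0<C_1\le C_2$ there is a constant $K>0$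 with the following property. Let $p\ge1$ and $d,m,\delta\ge 0$ be integers with $$C_1\log p\le\delta\le C_2\log p,\qquad m\ge K\sqrt{dp}\,\log p,$$ and let $\Omega\subseteq[p]\times[p]$ be a fixed $d$-distributed set. If $G_1,G_2$ are two independent uniformly random $\delta$-left-regular bipartite graphs from $[p]$ to $[m]$, then with probability exceeding $1-p^{-c}$ the tensor graph $G_1\otimes G_2$ has all three of the following properties: \begin{enumerate} \item $|N(\Omega)|\ge p\delta^2(1-\epsilon)$; \item for every $(i,i')\in([p]\times[p])\setminus\Omega$, $|N(i,i')\cap N(\Omega)|\le\epsilon\delta^2$; \item for every $(i,i')\in\Omega$, $|N(i,i')\cap N(\Omega\setminus\{(i,i')\})|\le\epsilon\delta^2$. \end{enumerate} The same holds, with the same constants, when $G_2=G_1$ is one uniformly random $\delta$-left-regular bipartite graph. -/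

import Mathlib

open MeasureTheory ProbabilityTheory

/-- A bipartite graph with left set `L` and right set `R`. Parallel edges are irrelevant for
neighbourhoods and are identified. -/
structure BipartiteGraph (L R : Type*) where
  Adj : L → R → Prop

namespace BipartiteGraph

/-- The set `N(S)` of right vertices adjacent to some left vertex in `S`. -/
def nbhd {L R : Type*} (G : BipartiteGraph L R) (S : Set L) : Set R :=
  {j | ∃ i ∈ S, G.Adj i j}

/-- The tensor graph: `(i, i')` is joined to `(j, j')` iff `i` is joined to `j` in the first
graph and `i'` is joined to `j'` in the second. -/
def tensor {L₁ R₁ L₂ R₂ : Type*} (G₁ : BipartiteGraph L₁ R₁) (G₂ : BipartiteGraph L₂ R₂) :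
    BipartiteGraph (L₁ × L₂) (R₁ × R₂) where
  Adj u v := G₁.Adj u.1 v.1 ∧ G₂.Adj u.2 v.2

/-- The graph in which the left vertex `i` is joined to `x i 0, …, x i (δ - 1)`
(repetitions allowed). -/
def ofTrials {p m δ : ℕ} (x : Fin p → Fin δ → Fin m) : BipartiteGraph (Fin p) (Fin m) where
  Adj i j := ∃ k, x i k = j

end BipartiteGraph

/-- The law of the trials that generate a uniformly random `δ`-left-regular bipartite graph:
for every left vertex `i`, the `δ` right vertices `x i k` are drawn uniformly from `Fin m`,
all draws being independent (sampling with replacement). The random graph itself is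
`BipartiteGraph.ofTrials x`. -/
noncomputable def trialLaw (p m δ : ℕ) : Measure (Fin p → Fin δ → Fin m) :=
  Measure.pi fun _ : Fin p => Measure.pi fun _ : Fin δ =>
    (uniformOn (Set.univ : Set (Fin m)) : Measure (Fin m))

/-- A subset of `[p] × [p]` is `d`-distributed if it contains the diagonal and meets every row
and every column in at most `d` points. -/
def IsDistributed {p : ℕ} (d : ℕ) (Ω : Set (Fin p × Fin p)) : Prop :=
  (∀ i, (i, i) ∈ Ω) ∧
    ∀ k, {q : Fin p × Fin p | q ∈ Ω ∧ q.1 = k}.ncard ≤ d ∧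
      {q : Fin p × Fin p | q ∈ Ω ∧ q.2 = k}.ncard ≤ d

/-- The three expansion properties of a bipartite graph `H` from `[p] × [p]` to `[m] × [m]`
relative to `Ω`. -/
structure WeakDistributedExpansion {p m : ℕ}
    (H : BipartiteGraph (Fin p × Fin p) (Fin m × Fin m))
    (Ω : Set (Fin p × Fin p)) (δ : ℕ) (ε : ℝ) : Prop where
  card_nbhd : (p : ℝ) * (δ : ℝ) ^ 2 * (1 - ε) ≤ ((H.nbhd Ω).ncard : ℝ)
  outside : ∀ u, u ∉ Ω →
    ((H.nbhd {u} ∩ H.nbhd Ω).ncard : ℝ) ≤ ε * (δ : ℝ) ^ 2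
  inside : ∀ u, u ∈ Ω →
    ((H.nbhd {u} ∩ H.nbhd (Ω \ {u})).ncard : ℝ) ≤ ε * (δ : ℝ) ^ 2

/-!
The proof is a union bound over rare configurations of coinciding draws. A single mechanism bounds
all probabilities (`unifProb_forall_exists_eq_le`): if `F` and `C` are disjoint sets of draws, then
every draw in `F` repeats a draw in `C` with probability at most `(|C| / m) ^ |F|`.

Both parts of the statement are treated together. All draws are indexed by `V × Fin δ`, where `V`
is `Fin p` when the two graphs coincide and `Fin p ⊕ Fin p` when they are independent; the two
graphs are obtained by pulling back along injections `Fin p → V`, and `Ω` becomes a set of pairs in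
`V × V`.

An outcome is `WellSpread` if few draws at a vertex repeat each other, if few draws along a row or
column of `Ω` hit the neighbourhoods of two given vertices `v` and `w`, and if few pairs of
distinct draws along `Ω` hit these neighbourhoods with both entries. For such outcomes
`N(v) × N(w)` meets the part of `N(Ω)` that comes from pairs other than `(v, w)` in at most
`6 δ² / 64` points (`WellSpread.card_overlap_le`). This is the second and third expansion property,
and the first follows because the neighbourhoods of the diagonal pairs are almost disjoint.

The probabilistic heart is the bound on pairs of hits, a quadratic statistic with dependent terms
(`unifProb_pairCount_le`). The set of hits is a random set `X` that contains a given `F` with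
probability at most `q ^ |F|`, where `q = 2 δ / m`. Let `T` be the number of pairs inside `X` that
is to be ruled out. If no column contains more than `τ` of the pairs, then they can be chosen one
after another, each time with a second entry that is new, in at least `(T - N τ) ^ s` ways, where
`s` is the number of choices and `N` bounds the number of draws used before the last one. Let `R` be
the set of admissible pairs and `D` a bound for its rows. The expected number of such sequences is
at most `(|R| q² + N D q) ^ s`, since every pair uses either two new draws, or one new draw and one
of the at most `N` old ones. With `s` proportional to `δ` and `m` at least `K √(d p) log p`, the
quotient of the two bounds is at most `p ^ (-a)`, with `a` as large as desired once `K` is large.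

Points `(a, a)` of an overlap may arise from a single draw and escape this count, but there are at
most `δ` of them. They matter only if `δ`, and with it `p`, is bounded; then `K` can be chosen such
that no two vertices are likely to share a neighbour at all.
-/

open scoped BigOperators

/-! ### Uniform probability on a finite type -/

open Classical in
/-- The probability of `P` under the uniform distribution on a finite type. -/
noncomputable def unifProb {X : Type*} [Fintype X] (P : X → Prop) : ℝ :=
  𝔼 x : X, if P x then 1 else 0

section unifProb

variable {X : Type*} [Fintype X]

theorem unifProb_eq_ncard_div (P : X → Prop) :
    unifProb P = ({x | P x}.ncard : ℝ) / Fintype.card X := by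
  classical
  rw [unifProb, Finset.expect_eq_sum_div_card, Finset.sum_boole, Finset.card_univ,
    Set.ncard_eq_toFinset_card']
  simp

theorem unifProb_le_expect {P : X → Prop} {f : X → ℝ} (h0 : ∀ x, 0 ≤ f x)
    (h : ∀ x, P x → 1 ≤ f x) : unifProb P ≤ 𝔼 x, f x := by
  classical
  refine Finset.expect_le_expect fun x _ => ?_
  split_ifs with hx
  · exact h x hx
  · exact h0 x

theorem unifProb_mono {P Q : X → Prop} (h : ∀ x, P x → Q x) : unifProb P ≤ unifProb Q := by
  classical
  refine unifProb_le_expect (fun x => by split_ifs <;> norm_num) fun x hx => ?_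
  simp [h x hx]

theorem unifProb_or_le (P Q : X → Prop) :
    unifProb (fun x => P x ∨ Q x) ≤ unifProb P + unifProb Q := by
  classical
  refine le_trans ?_ (Finset.expect_add_distrib _ _ _).le
  refine unifProb_le_expect (fun x => by split_ifs <;> norm_num) fun x hx => ?_
  rcases hx with hx | hx <;> simp only [hx, if_true] <;> split_ifs <;> norm_num

theorem unifProb_exists_mem_le {ι : Type*} (s : Finset ι) (P : ι → X → Prop) :
    unifProb (fun x => ∃ i ∈ s, P i x) ≤ ∑ i ∈ s, unifProb (P i) := by
  classical
  simp only [unifProb]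
  rw [← Finset.expect_sum_comm]
  refine unifProb_le_expect
    (fun x => Finset.sum_nonneg fun i _ => by split_ifs <;> norm_num) fun x hx => ?_
  obtain ⟨i, hi, hx⟩ := hx
  refine le_trans (by simp [hx]) (Finset.single_le_sum
    (f := fun i => if P i x then (1 : ℝ) else 0) (fun i _ => by split_ifs <;> norm_num) hi)

theorem unifProb_exists_mem_le_of_le {ι : Type*} (s : Finset ι) (P : ι → X → Prop) {b : ℝ}
    (h : ∀ i ∈ s, unifProb (P i) ≤ b) :
    unifProb (fun x => ∃ i ∈ s, P i x) ≤ s.card * b := by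
  refine (unifProb_exists_mem_le s P).trans ?_
  simpa using Finset.sum_le_sum h

theorem unifProb_of_forall_not {P : X → Prop} (h : ∀ x, ¬ P x) : unifProb P = 0 := by
  simp [unifProb, h]

theorem unifProb_not [Nonempty X] (P : X → Prop) : unifProb (fun x => ¬ P x) = 1 - unifProb P := by
  classical
  rw [eq_sub_iff_add_eq, unifProb, unifProb, ← Finset.expect_add_distrib,
    ← Finset.expect_const (s := (Finset.univ : Finset X)) Finset.univ_nonempty (1 : ℝ)]
  refine Finset.expect_congr rfl fun x _ => ?_
  by_cases h : P x <;> simp [h]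

/-- Union bound over the `t`-subsets of `Y`, each of which is bad with probability at most
`q ^ t`. -/
theorem unifProb_exists_subset_le {E : Type*} (Y : Finset E) (t : ℕ) (ht : 0 < t) {q b : ℝ}
    (hq : 0 ≤ q) (hb : Real.exp 1 * (Y.card * q) ≤ b * t) (G : Finset E → X → Prop)
    (hG : ∀ F ⊆ Y, F.card = t → unifProb (G F) ≤ q ^ t) :
    unifProb (fun x => ∃ F ⊆ Y, F.card = t ∧ G F x) ≤ b ^ t := by
  have h1 : unifProb (fun x => ∃ F ⊆ Y, F.card = t ∧ G F x) ≤ (Y.card.choose t : ℝ) * q ^ t := by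
    rw [← Finset.card_powersetCard]
    refine le_trans (unifProb_mono fun x hx => ?_)
      (unifProb_exists_mem_le_of_le (Y.powersetCard t) G fun F hF => ?_)
    · obtain ⟨F, h1, h2, h3⟩ := hx
      exact ⟨F, Finset.mem_powersetCard.2 ⟨h1, h2⟩, h3⟩
    · obtain ⟨h1, h2⟩ := Finset.mem_powersetCard.1 hF
      exact hG F h1 h2
  have ht' : (0 : ℝ) < t := by exact_mod_cast ht
  refine h1.trans ?_
  calc (Y.card.choose t : ℝ) * q ^ t
      ≤ ((Y.card : ℝ) ^ t / t.factorial) * q ^ t := by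
        gcongr
        exact Nat.choose_le_pow_div t Y.card
    _ = (Y.card * q / t) ^ t * ((t : ℝ) ^ t / t.factorial) := by
        rw [div_pow, mul_pow]; field_simp
    _ ≤ (Y.card * q / t) ^ t * Real.exp t := by
        gcongr
        exact Real.pow_div_factorial_le_exp _ ht'.le t
    _ = (Real.exp 1 * (Y.card * q) / t) ^ t := by
        rw [← Real.exp_one_pow t]; simp only [div_pow, mul_pow]; ring
    _ ≤ b ^ t := by
        gcongr
        rwa [div_le_iff₀ ht']

end unifProb

/-- If the draws in `F` are disjoint from those in `C`, then the probability that every draw in `F`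
repeats a draw from `C` is at most `(|C| / m) ^ |F|`: such an outcome is determined by the draws
outside `F` together with a map `F → C`. -/
theorem unifProb_forall_exists_eq_le {V : Type*} [Fintype V] [DecidableEq V] {m δ : ℕ} (hm : 0 < m)
    (F C : Finset (V × Fin δ)) (hFC : Disjoint F C) :
    unifProb (fun x : V → Fin δ → Fin m => ∀ e ∈ F, ∃ c ∈ C, x e.1 e.2 = x c.1 c.2) ≤
      ((C.card : ℝ) / m) ^ F.card := by
  classical
  set P : (V → Fin δ → Fin m) → Prop := fun x => ∀ e ∈ F, ∃ c ∈ C, x e.1 e.2 = x c.1 c.2 with hP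
  have hch : ∀ x : {x // P x}, ∃ φ : F → C, ∀ e : F, x.1 e.1.1 e.1.2 = x.1 (φ e).1.1 (φ e).1.2 := by
    intro x
    have : ∀ e : F, ∃ c : C, x.1 e.1.1 e.1.2 = x.1 c.1.1 c.1.2 := fun e => by
      obtain ⟨c, hc, h⟩ := x.2 e.1 e.2
      exact ⟨⟨c, hc⟩, h⟩
    choose φ h using this
    exact ⟨φ, h⟩
  choose φ hφ using hch
  have hinj : Function.Injective
      (fun x : {x // P x} => ((φ x, fun e : (Fᶜ : Finset (V × Fin δ)) => x.1 e.1.1 e.1.2) :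
        (F → C) × ((Fᶜ : Finset (V × Fin δ)) → Fin m))) := by
    intro x y hxy
    obtain ⟨h1, h2⟩ := Prod.mk.inj hxy
    have h3 : ∀ e ∉ F, x.1 e.1 e.2 = y.1 e.1 e.2 := fun e he =>
      congrFun h2 ⟨e, Finset.mem_compl.2 he⟩
    ext k l : 3
    by_cases he : (k, l) ∈ F
    · have hx := hφ x ⟨_, he⟩
      have hy := hφ y ⟨_, he⟩
      rw [← h1] at hy
      refine hx.trans (Eq.trans (h3 _ fun h => ?_) hy.symm)
      exact Finset.disjoint_left.1 hFC h (φ x ⟨_, he⟩).2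
    · exact h3 _ he
  have hcard := Fintype.card_le_of_injective _ hinj
  simp only [Fintype.card_prod, Fintype.card_fun, Fintype.card_coe, Fintype.card_fin] at hcard
  have hsplit : Fintype.card (V → Fin δ → Fin m) = m ^ F.card * m ^ (Fᶜ).card := by
    rw [← pow_add, Finset.card_add_card_compl]
    simp [Fintype.card_prod, ← pow_mul, mul_comm]
  rw [unifProb_eq_ncard_div, hsplit, ← Nat.card_coe_set_eq, div_pow]
  have hm' : (0 : ℝ) < m := by exact_mod_cast hm
  rw [div_le_div_iff₀ (by positivity) (by positivity)]
  have h4 : (Nat.card {x // P x} : ℝ) ≤ (C.card : ℝ) ^ F.card * (m : ℝ) ^ (Fᶜ).card := by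
    rw [Nat.card_eq_fintype_card]; exact_mod_cast hcard
  calc (Nat.card {x // P x} : ℝ) * (m : ℝ) ^ F.card
      ≤ ((C.card : ℝ) ^ F.card * (m : ℝ) ^ (Fᶜ).card) * (m : ℝ) ^ F.card := by gcongr
    _ = _ := by push_cast; ring

/-! ### Pairs of a relation inside a random set -/

section PairCount

variable {E : Type*} [DecidableEq E]

/-- The number of sequences of `s` pairs from `R` that, together with `F`, lie in `X`, where the
second entry of each pair avoids `F` and all earlier pairs. -/
noncomputable def chainCount (R : Finset (E × E)) (X : Finset E) : ℕ → Finset E → ℝ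
  | 0, F => if F ⊆ X then 1 else 0
  | s + 1, F => ∑ r ∈ R with r.2 ∉ F, chainCount R X s (insert r.1 (insert r.2 F))

theorem chainCount_nonneg (R : Finset (E × E)) (X : Finset E) (s : ℕ) (F : Finset E) :
    0 ≤ chainCount R X s F := by
  induction s generalizing F with
  | zero => rw [chainCount]; split_ifs <;> norm_num
  | succ s ih => rw [chainCount]; exact Finset.sum_nonneg fun r _ => ih _

/-- Many pairs of `R` inside `X`, with few of them sharing their second entry, give many
sequences: an element that has been used excludes at most `τ` of the pairs. -/
theorem pow_le_chainCount (R : Finset (E × E)) (X : Finset E) {T τ : ℝ} {N : ℕ} (hτ0 : 0 ≤ τ)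
    (hτ : ∀ e, ((R.filter fun r => r.2 = e ∧ r.1 ∈ X).card : ℝ) ≤ τ) (hN : N * τ ≤ T)
    (hT : T ≤ ((R.filter fun r => r.1 ∈ X ∧ r.2 ∈ X).card : ℝ)) (s : ℕ) (F : Finset E)
    (hF : F ⊆ X) (hs : F.card + 2 * s ≤ N + 2) : (T - N * τ) ^ s ≤ chainCount R X s F := by
  induction s generalizing F with
  | zero => simp [chainCount, hF]
  | succ s ih =>
    have hpos : 0 ≤ T - N * τ := sub_nonneg.2 hN
    set R' := R.filter fun r => (r.1 ∈ X ∧ r.2 ∈ X) ∧ r.2 ∉ F with hR'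
    have hcount : T - N * τ ≤ (R'.card : ℝ) := by
      have hsub : (R.filter fun r => r.1 ∈ X ∧ r.2 ∈ X) ⊆
          R' ∪ F.biUnion fun e => R.filter fun r => r.2 = e ∧ r.1 ∈ X := by
        intro r hr
        simp only [hR', Finset.mem_filter, Finset.mem_union, Finset.mem_biUnion] at hr ⊢
        by_cases h : r.2 ∈ F
        · exact Or.inr ⟨r.2, h, hr.1, rfl, hr.2.1⟩
        · exact Or.inl ⟨hr.1, hr.2, h⟩
      have h1 : ((R.filter fun r => r.1 ∈ X ∧ r.2 ∈ X).card : ℝ) ≤ R'.card +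
          ∑ e ∈ F, ((R.filter fun r => r.2 = e ∧ r.1 ∈ X).card : ℝ) := by
        exact_mod_cast (Finset.card_le_card hsub).trans
          ((Finset.card_union_le _ _).trans (Nat.add_le_add_left Finset.card_biUnion_le _))
      have h2 : ∑ e ∈ F, ((R.filter fun r => r.2 = e ∧ r.1 ∈ X).card : ℝ) ≤ F.card * τ := by
        simpa using Finset.sum_le_sum fun e (_ : e ∈ F) => hτ e
      have h3 : (F.card : ℝ) * τ ≤ N * τ := by
        have : F.card ≤ N := by omega
        gcongr
      linarith
    rw [chainCount, pow_succ']
    calc (T - N * τ) * (T - N * τ) ^ s ≤ R'.card * (T - N * τ) ^ s := by gcongr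
      _ = ∑ r ∈ R', (T - N * τ) ^ s := by simp
      _ ≤ ∑ r ∈ R', chainCount R X s (insert r.1 (insert r.2 F)) := by
        refine Finset.sum_le_sum fun r hr => ih _ ?_ ?_
        · simp only [hR', Finset.mem_filter] at hr
          exact Finset.insert_subset hr.2.1.1 (Finset.insert_subset hr.2.1.2 hF)
        · have h1 := Finset.card_insert_le r.1 (insert r.2 F)
          have h2 := Finset.card_insert_le r.2 F
          omega
      _ ≤ _ := by
        refine Finset.sum_le_sum_of_subset_of_nonneg (fun r hr => ?_)
          fun r _ _ => chainCount_nonneg _ _ _ _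
        simp only [hR', Finset.mem_filter] at hr ⊢
        exact ⟨hr.1, hr.2.2⟩

/-- The expected number of sequences, for a random set `X` that contains any given `F` with
probability at most `q ^ |F|`. A pair whose first entry is new costs `q ^ 2`; a pair whose first
entry has been used before costs `q`, but there are few of them. -/
theorem expect_chainCount_le {Ω : Type*} [Fintype Ω] (X : Ω → Finset E) (R : Finset (E × E))
    (hR : ∀ r ∈ R, r.1 ≠ r.2) {q : ℝ} (hq : 0 ≤ q)
    (hX : ∀ F : Finset E, unifProb (fun ω => F ⊆ X ω) ≤ q ^ F.card) {D N : ℕ}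
    (hD : ∀ e, (R.filter fun r => r.1 = e).card ≤ D) (s : ℕ) (F : Finset E)
    (hs : F.card + 2 * s ≤ N + 2) :
    𝔼 ω, chainCount R (X ω) s F ≤ q ^ F.card * (R.card * q ^ 2 + N * D * q) ^ s := by
  induction s generalizing F with
  | zero =>
    simp only [chainCount, pow_zero, mul_one]
    refine le_trans (le_of_eq ?_) (hX F)
    unfold unifProb
    congr 1; ext ω; congr
  | succ s ih =>
    set B := (R.card * q ^ 2 + N * D * q : ℝ) with hB
    have hB0 : 0 ≤ B := by positivity
    have hN : F.card ≤ N := by omega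
    simp only [chainCount]
    rw [Finset.expect_sum_comm]
    have key : ∀ r ∈ R.filter (fun r => r.2 ∉ F),
        𝔼 ω, chainCount R (X ω) s (insert r.1 (insert r.2 F)) ≤
          q ^ F.card * B ^ s * (q ^ 2 + if r.1 ∈ F then q else 0) := by
      intro r hr
      obtain ⟨hr1, hr2⟩ := Finset.mem_filter.1 hr
      have h1 := Finset.card_insert_le r.1 (insert r.2 F)
      have h2 := Finset.card_insert_le r.2 F
      refine (ih _ (by omega)).trans ?_
      have h3 := Finset.card_insert_of_notMem hr2
      by_cases h : r.1 ∈ F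
      · rw [Finset.insert_eq_of_mem (Finset.mem_insert_of_mem h), h3, if_pos h, pow_succ]
        have : 0 ≤ q ^ F.card * B ^ s * q ^ 2 := by positivity
        linarith
      · have h4 : r.1 ∉ insert r.2 F := by
          simp [h, hR r hr1]
        rw [Finset.card_insert_of_notMem h4, h3, if_neg h]
        apply le_of_eq; ring
    refine (Finset.sum_le_sum key).trans ?_
    rw [← Finset.mul_sum, pow_succ B, ← mul_assoc]
    refine mul_le_mul_of_nonneg_left ?_ (by positivity)
    rw [Finset.sum_add_distrib, ← Finset.sum_filter, Finset.sum_const, Finset.sum_const,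
      nsmul_eq_mul, nsmul_eq_mul]
    have h5 : ((R.filter fun r => r.2 ∉ F).filter fun r => r.1 ∈ F).card ≤ F.card * D := by
      calc _ ≤ (F.biUnion fun e => R.filter fun r => r.1 = e).card := by
            refine Finset.card_le_card fun r hr => ?_
            simp only [Finset.mem_filter, Finset.mem_biUnion] at hr ⊢
            exact ⟨r.1, hr.2, hr.1.1, rfl⟩
        _ ≤ F.card * D := Finset.card_biUnion_le_card_mul _ _ _ fun e _ => hD e
    have h6 : (((R.filter fun r => r.2 ∉ F).filter fun r => r.1 ∈ F).card : ℝ) ≤ N * D := by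
      exact_mod_cast h5.trans (Nat.mul_le_mul_right _ hN)
    rw [hB]
    gcongr
    exact Finset.filter_subset _ _

/-- A random set that contains any given `F` with probability at most `q ^ |F|` is unlikely to
contain `T` pairs of a sparse relation while every column contains at most `τ` of them. -/
theorem unifProb_pairCount_le {Ω : Type*} [Fintype Ω] (X : Ω → Finset E) (R : Finset (E × E))
    (hR : ∀ r ∈ R, r.1 ≠ r.2) {q : ℝ} (hq : 0 ≤ q)
    (hX : ∀ F : Finset E, unifProb (fun ω => F ⊆ X ω) ≤ q ^ F.card) {D N : ℕ}
    (hD : ∀ e, (R.filter fun r => r.1 = e).card ≤ D) {T τ b : ℝ} (hτ : 0 ≤ τ) (hN : N * τ < T)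
    {s : ℕ} (hs : 2 * s ≤ N + 2) (hb : R.card * q ^ 2 + N * D * q ≤ b * (T - N * τ)) :
    unifProb (fun ω => (∀ e, ((R.filter fun r => r.2 = e ∧ r.1 ∈ X ω).card : ℝ) ≤ τ) ∧
      T ≤ ((R.filter fun r => r.1 ∈ X ω ∧ r.2 ∈ X ω).card : ℝ)) ≤ b ^ s := by
  have hpos : 0 < T - N * τ := sub_pos.2 hN
  have h1 := expect_chainCount_le X R hR hq hX hD (N := N) s ∅ (by simpa using hs)
  simp only [Finset.card_empty, pow_zero, one_mul] at h1
  calc _ ≤ 𝔼 ω, chainCount R (X ω) s ∅ / (T - N * τ) ^ s := by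
        refine unifProb_le_expect
          (fun ω => div_nonneg (chainCount_nonneg _ _ _ _) (by positivity)) fun ω hω => ?_
        rw [one_le_div (by positivity)]
        exact pow_le_chainCount R (X ω) hτ hω.1 hN.le hω.2 s ∅ (Finset.empty_subset _)
          (by simpa using hs)
    _ = (𝔼 ω, chainCount R (X ω) s ∅) / (T - N * τ) ^ s := by rw [Finset.expect_div]
    _ ≤ (b * (T - N * τ)) ^ s / (T - N * τ) ^ s := by
        gcongr
        exact h1.trans (by gcongr)
    _ = b ^ s := by rw [mul_pow]; field_simp

end PairCount

/-! ### Well-spread outcomes of the trials -/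

section Spread

variable {V : Type*} {m δ : ℕ}

/-- The neighbourhood of the left vertex `v`, as a finset. -/
def nb (x : V → Fin δ → Fin m) (v : V) : Finset (Fin m) := Finset.univ.image (x v)

theorem mem_nb {x : V → Fin δ → Fin m} {v : V} {a : Fin m} : a ∈ nb x v ↔ ∃ l, x v l = a := by
  simp [nb]

theorem card_nb_le (x : V → Fin δ → Fin m) (v : V) : (nb x v).card ≤ δ := by
  simpa [nb] using Finset.card_image_le (s := Finset.univ) (f := x v)

variable [Fintype V] [DecidableEq V]

/-- The draws of left vertices other than `v` and `w` that hit the neighbourhood of `v` or of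
`w`. -/
def hits (v w : V) (x : V → Fin δ → Fin m) : Finset (V × Fin δ) :=
  Finset.univ.filter fun e => (e.1 ≠ v ∧ e.1 ≠ w) ∧ x e.1 e.2 ∈ nb x v ∪ nb x w

/-- Pairs of distinct draws whose left vertices form a pair in `Ω`. -/
def drawPairs (δ : ℕ) (Ω : Finset (V × V)) : Finset ((V × Fin δ) × (V × Fin δ)) :=
  Finset.univ.filter fun r => (r.1.1, r.2.1) ∈ Ω ∧ r.1 ≠ r.2

/-- The rows and columns of `Ω`, and the singletons, as sets of left vertices. -/
def lines (Ω : Finset (V × V)) : Finset (Finset V) :=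
  (Finset.univ.image fun v => Finset.univ.filter fun w => (v, w) ∈ Ω) ∪
    (Finset.univ.image fun w => Finset.univ.filter fun v => (v, w) ∈ Ω) ∪
      Finset.univ.image fun v => {v}

/-- The outcomes with few coincidences: almost no repeated draws at a vertex, few hits along every
line of `Ω`, few pairs of hits along `Ω`, and, when `δ` is bounded, disjoint neighbourhoods. -/
structure WellSpread (Ω : Finset (V × V)) (x : V → Fin δ → Fin m) : Prop where
  card_nb : ∀ v, (63 / 64 : ℝ) * δ ≤ ((nb x v).card : ℝ)
  hits_line : ∀ v w, ∀ W ∈ lines Ω,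
    (((hits v w x).filter fun e => e.1 ∈ W).card : ℝ) ≤ (1 / 64 : ℝ) * δ
  hits_pair : ∀ v w,
    (((drawPairs δ Ω).filter fun r => r.1 ∈ hits v w x ∧ r.2 ∈ hits v w x).card : ℝ) ≤
      (1 / 64 : ℝ) * (δ : ℝ) ^ 2
  disjoint : δ < 64 → ∀ v w, v ≠ w → Disjoint (nb x v) (nb x w)

/-- The pairs in `N(v) × N(w)` that are also covered by a pair of `Ω` other than `(v, w)`. -/
def overlap (Ω : Finset (V × V)) (x : V → Fin δ → Fin m) (v w : V) : Finset (Fin m × Fin m) :=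
  (nb x v ×ˢ nb x w).filter fun c => ∃ k ∈ Ω, k ≠ (v, w) ∧ c.1 ∈ nb x k.1 ∧ c.2 ∈ nb x k.2

theorem mem_hits {v w : V} {x : V → Fin δ → Fin m} {e : V × Fin δ} :
    e ∈ hits v w x ↔ (e.1 ≠ v ∧ e.1 ≠ w) ∧ (x e.1 e.2 ∈ nb x v ∨ x e.1 e.2 ∈ nb x w) := by
  simp [hits]

theorem card_filter_nb_le (x : V → Fin δ → Fin m) (v : V) (W : Finset V) :
    ((nb x v).filter fun a => ∃ k ∈ W, k ≠ v ∧ a ∈ nb x k).card ≤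
      ((hits v v x).filter fun e => e.1 ∈ W).card := by
  refine Finset.card_le_card_of_surjOn (fun e => x e.1 e.2) fun a ha => ?_
  simp only [Finset.coe_filter, Set.mem_ofPred_eq] at ha
  obtain ⟨ha, k, hk, hkv, hak⟩ := ha
  obtain ⟨l, rfl⟩ := mem_nb.1 hak
  refine ⟨(k, l), ?_, rfl⟩
  simp [mem_hits, hkv, ha, hk]

namespace WellSpread

variable {Ω : Finset (V × V)} {x : V → Fin δ → Fin m}

theorem card_filter_nb_le (hx : WellSpread Ω x) (v : V) {W : Finset V} (hW : W ∈ lines Ω) :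
    (((nb x v).filter fun a => ∃ k ∈ W, k ≠ v ∧ a ∈ nb x k).card : ℝ) ≤ (1 / 64 : ℝ) * δ :=
  le_trans (by exact_mod_cast _root_.card_filter_nb_le x v W) (hx.hits_line v v W hW)

/-- The overlap of `N(v) × N(w)` with the rest of `N(Ω)` is small. Pairs of `Ω` that involve `v` or
`w` are controlled by the hits along lines. The other pairs contribute pairs of distinct draws,
controlled by `hits_pair`, or a single draw, which gives a point `(a, a)`; there are at most `δ` of
these, which is negligible unless `δ` is bounded, when there are none. -/
theorem card_overlap_le (hx : WellSpread Ω x) (v w : V) :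
    ((overlap Ω x v w).card : ℝ) ≤ 6 / 64 * (δ : ℝ) ^ 2 := by
  set row := Finset.univ.filter fun k => (v, k) ∈ Ω with hrow
  set col := Finset.univ.filter fun k => (k, w) ∈ Ω with hcol
  have hrowL : row ∈ lines Ω := by simp [lines, hrow]
  have hcolL : col ∈ lines Ω := by simp [lines, hcol]
  have hsing : ∀ k, {k} ∈ lines Ω := by simp [lines]
  set P₁ := nb x v ×ˢ (nb x w).filter fun a => ∃ k ∈ row, k ≠ w ∧ a ∈ nb x k with hP₁
  set P₂ := ((nb x v).filter fun a => ∃ k ∈ col, k ≠ v ∧ a ∈ nb x k) ×ˢ nb x w with hP₂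
  set P₃ := ((nb x v).filter fun a => ∃ k ∈ ({w} : Finset V), k ≠ v ∧ a ∈ nb x k) ×ˢ nb x w
    with hP₃
  set P₄ := nb x v ×ˢ (nb x w).filter fun a => ∃ k ∈ ({v} : Finset V), k ≠ w ∧ a ∈ nb x k
    with hP₄
  set P₅ := ((drawPairs δ Ω).filter fun r => r.1 ∈ hits v w x ∧ r.2 ∈ hits v w x).image
    fun r => (x r.1.1 r.1.2, x r.2.1 r.2.2) with hP₅
  set P₆ := ((nb x v).filter fun a => ∃ k, k ≠ v ∧ a ∈ nb x k).image fun a => (a, a) with hP₆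
  have hsub : overlap Ω x v w ⊆ P₁ ∪ P₂ ∪ P₃ ∪ P₄ ∪ P₅ ∪ P₆ := by
    rintro ⟨a, b⟩ hc
    simp only [overlap, Finset.mem_filter, Finset.mem_product] at hc
    obtain ⟨⟨ha, hb⟩, ⟨k, k'⟩, hk, hne, hak, hbk⟩ := hc
    simp only [Finset.mem_union, or_assoc]
    by_cases h1 : k = v
    · subst h1
      have : k' ≠ w := fun h => hne (by rw [h])
      left
      simp only [hP₁, hrow, Finset.mem_product, Finset.mem_filter, Finset.mem_univ, true_and]
      exact ⟨ha, hb, k', hk, this, hbk⟩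
    by_cases h2 : k' = w
    · subst h2
      right; left
      simp only [hP₂, hcol, Finset.mem_product, Finset.mem_filter, Finset.mem_univ, true_and]
      exact ⟨⟨ha, k, hk, h1, hak⟩, hb⟩
    by_cases h3 : k = w
    · subst h3
      right; right; left
      simp only [hP₃, Finset.mem_product, Finset.mem_filter, Finset.mem_singleton]
      exact ⟨⟨ha, k, rfl, h1, hak⟩, hb⟩
    by_cases h4 : k' = v
    · subst h4
      right; right; right; left
      simp only [hP₄, Finset.mem_product, Finset.mem_filter, Finset.mem_singleton]
      exact ⟨ha, hb, k', rfl, h2, hbk⟩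
    right; right; right; right
    obtain ⟨l, rfl⟩ := mem_nb.1 hak
    obtain ⟨l', rfl⟩ := mem_nb.1 hbk
    by_cases h5 : (k, l) = (k', l')
    · right
      obtain ⟨rfl, rfl⟩ := Prod.mk.inj h5
      simp only [hP₆, Finset.mem_image, Finset.mem_filter]
      exact ⟨_, ⟨ha, k, h1, hak⟩, rfl⟩
    · left
      simp only [hP₅, Finset.mem_image, Finset.mem_filter, drawPairs, Finset.mem_univ, true_and,
        mem_hits]
      exact ⟨((k, l), (k', l')), ⟨⟨hk, h5⟩, ⟨⟨h1, h3⟩, Or.inl ha⟩, ⟨⟨h4, h2⟩, Or.inr hb⟩⟩, rfl⟩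
  have hcard : ((overlap Ω x v w).card : ℝ) ≤
      P₁.card + P₂.card + P₃.card + P₄.card + P₅.card + P₆.card := by
    have h := Finset.card_le_card hsub
    have h1 := Finset.card_union_le (P₁ ∪ P₂ ∪ P₃ ∪ P₄ ∪ P₅) P₆
    have h2 := Finset.card_union_le (P₁ ∪ P₂ ∪ P₃ ∪ P₄) P₅
    have h3 := Finset.card_union_le (P₁ ∪ P₂ ∪ P₃) P₄
    have h4 := Finset.card_union_le (P₁ ∪ P₂) P₃
    have h5 := Finset.card_union_le P₁ P₂
    exact_mod_cast (by omega : (overlap Ω x v w).card ≤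
      P₁.card + P₂.card + P₃.card + P₄.card + P₅.card + P₆.card)
  have hnb : ∀ u, ((nb x u).card : ℝ) ≤ δ := fun u => by exact_mod_cast card_nb_le x u
  have c₁ : (P₁.card : ℝ) ≤ δ * (1 / 64 * δ) := by
    rw [hP₁, Finset.card_product, Nat.cast_mul]
    exact mul_le_mul (hnb v) (hx.card_filter_nb_le w hrowL) (by positivity) (by positivity)
  have c₂ : (P₂.card : ℝ) ≤ (1 / 64 * δ) * δ := by
    rw [hP₂, Finset.card_product, Nat.cast_mul]
    exact mul_le_mul (hx.card_filter_nb_le v hcolL) (hnb w) (by positivity) (by positivity)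
  have c₃ : (P₃.card : ℝ) ≤ (1 / 64 * δ) * δ := by
    rw [hP₃, Finset.card_product, Nat.cast_mul]
    exact mul_le_mul (hx.card_filter_nb_le v (hsing w)) (hnb w) (by positivity) (by positivity)
  have c₄ : (P₄.card : ℝ) ≤ δ * (1 / 64 * δ) := by
    rw [hP₄, Finset.card_product, Nat.cast_mul]
    exact mul_le_mul (hnb v) (hx.card_filter_nb_le w (hsing v)) (by positivity) (by positivity)
  have c₅ : (P₅.card : ℝ) ≤ 1 / 64 * (δ : ℝ) ^ 2 :=
    le_trans (by exact_mod_cast Finset.card_image_le) (hx.hits_pair v w)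
  have c₆ : (P₆.card : ℝ) ≤ 1 / 64 * (δ : ℝ) ^ 2 := by
    rcases lt_or_ge δ 64 with h | h
    · have : P₆ = ∅ := by
        rw [hP₆, Finset.image_eq_empty, Finset.filter_eq_empty_iff]
        rintro a ha ⟨k, hk, hak⟩
        exact Finset.disjoint_left.1 (hx.disjoint h k v hk) hak ha
      rw [this]; simp
    · have h1 : (P₆.card : ℝ) ≤ δ := le_trans
        (by exact_mod_cast Finset.card_image_le.trans (Finset.card_filter_le _ _)) (hnb v)
      have h2 : (64 : ℝ) ≤ δ := by exact_mod_cast h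
      nlinarith
  nlinarith

/-- A well-spread outcome has the three expansion properties. The lower bound on `|N(Ω)|` counts,
for every diagonal pair, the part of its neighbourhood that no other pair of `Ω` covers. -/
theorem weakDistributedExpansion {p : ℕ} {f g : Fin p → V} (hf : f.Injective) (hg : g.Injective)
    (S : Set (Fin p × Fin p)) (hS : ∀ i, (i, i) ∈ S)
    (hΩ : ∀ k, k ∈ Ω ↔ ∃ s ∈ S, Prod.map f g s = k) (hx : WellSpread Ω x) :
    WeakDistributedExpansion ((BipartiteGraph.ofTrials (x ∘ f)).tensor
      (BipartiteGraph.ofTrials (x ∘ g))) S δ (1 / 8) := by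
  set H := (BipartiteGraph.ofTrials (x ∘ f)).tensor (BipartiteGraph.ofTrials (x ∘ g)) with hH
  have hadj : ∀ u c, H.Adj u c ↔ c.1 ∈ nb x (f u.1) ∧ c.2 ∈ nb x (g u.2) := by
    intro u c
    simp [hH, BipartiteGraph.tensor, BipartiteGraph.ofTrials, mem_nb]
  have hover : ∀ u, (H.nbhd {u} ∩ H.nbhd (S \ {u})) ⊆
      (overlap Ω x (f u.1) (g u.2) : Set (Fin m × Fin m)) := by
    rintro u c ⟨⟨u', hu', h1⟩, ⟨t, ⟨htS, htu⟩, h2⟩⟩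
    rw [Set.mem_singleton_iff] at hu'
    subst hu'
    rw [hadj] at h1 h2
    simp only [overlap, Finset.coe_filter, Set.mem_ofPred_eq, Finset.mem_product]
    refine ⟨h1, Prod.map f g t, (hΩ _).2 ⟨t, htS, rfl⟩, fun h => htu ?_, h2⟩
    exact (hf.prodMap hg) h
  have hcard : ∀ u, ((H.nbhd {u} ∩ H.nbhd (S \ {u})).ncard : ℝ) ≤ 6 / 64 * (δ : ℝ) ^ 2 := by
    intro u
    refine le_trans ?_ (hx.card_overlap_le (f u.1) (g u.2))
    rw [← Set.ncard_coe_finset]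
    exact_mod_cast Set.ncard_le_ncard (hover u) (Set.toFinite _)
  have hle : 6 / 64 * (δ : ℝ) ^ 2 ≤ 1 / 8 * (δ : ℝ) ^ 2 := by nlinarith [sq_nonneg (δ : ℝ)]
  refine ⟨?_, fun u hu => ?_, fun u _ => (hcard u).trans hle⟩
  · -- the neighbours of `(i, i)` that no other pair of `S` covers
    set priv : Fin p → Finset (Fin m × Fin m) := fun i =>
      (nb x (f i) ×ˢ nb x (g i)) \ overlap Ω x (f i) (g i) with hpriv
    have hmem : ∀ i c, c ∈ priv i → c ∈ H.nbhd S ∧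
        ∀ t ∈ S, t ≠ (i, i) → ¬ H.Adj t c := by
      intro i c hc
      rw [hpriv, Finset.mem_sdiff, Finset.mem_product] at hc
      refine ⟨⟨(i, i), hS i, (hadj _ _).2 hc.1⟩, fun t ht hti h => hc.2 ?_⟩
      rw [hadj] at h
      simp only [overlap, Finset.mem_filter, Finset.mem_product]
      refine ⟨hc.1, Prod.map f g t, (hΩ _).2 ⟨t, ht, rfl⟩, fun h' => hti ?_, h⟩
      exact (hf.prodMap hg) (h'.trans rfl : Prod.map f g t = Prod.map f g (i, i))
    have hdisj : ((Finset.univ : Finset (Fin p)) : Set (Fin p)).PairwiseDisjoint priv := by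
      intro i _ j _ hij
      refine Finset.disjoint_left.2 fun c hi hj => ?_
      refine (hmem i c hi).2 (j, j) (hS j) (fun h => hij (Prod.mk.inj h).1.symm) ?_
      rw [hpriv, Finset.mem_sdiff, Finset.mem_product] at hj
      exact (hadj _ _).2 hj.1
    have hpc : ∀ i, (7 / 8 : ℝ) * (δ : ℝ) ^ 2 ≤ (priv i).card := by
      intro i
      have h1 : (((nb x (f i) ×ˢ nb x (g i)).card : ℕ) : ℝ) ≤
          (priv i).card + (overlap Ω x (f i) (g i)).card := by
        rw [add_comm]
        exact_mod_cast (Nat.sub_le_iff_le_add'.1 (Finset.le_card_sdiff _ _))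
      rw [Finset.card_product, Nat.cast_mul] at h1
      have h2 := hx.card_overlap_le (f i) (g i)
      have h3 := mul_le_mul (hx.card_nb (f i)) (hx.card_nb (g i)) (by positivity) (by positivity)
      nlinarith [sq_nonneg (δ : ℝ)]
    have hsub : ((Finset.univ.biUnion priv : Finset _) : Set (Fin m × Fin m)) ⊆ H.nbhd S := by
      intro c hc
      simp only [Finset.coe_biUnion, Set.mem_iUnion] at hc
      obtain ⟨i, -, hc⟩ := hc
      exact (hmem i c hc).1
    calc (p : ℝ) * (δ : ℝ) ^ 2 * (1 - 1 / 8) = ∑ _i : Fin p, (7 / 8 : ℝ) * (δ : ℝ) ^ 2 := by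
          simp; ring
      _ ≤ ∑ i, ((priv i).card : ℝ) := Finset.sum_le_sum fun i _ => hpc i
      _ = ((Finset.univ.biUnion priv).card : ℝ) := by
          rw [Finset.card_biUnion hdisj]; push_cast; rfl
      _ ≤ _ := by
          rw [← Set.ncard_coe_finset]
          exact_mod_cast Set.ncard_le_ncard hsub (Set.toFinite _)
  · have h := hcard u
    rw [Set.sdiff_singleton_eq_self hu] at h
    exact h.trans hle

end WellSpread

end Spread

/-! ### Most outcomes are well spread -/

section Probability

variable {V : Type*} [Fintype V] [DecidableEq V] {m δ d : ℕ}

theorem unifProb_subset_hits_le (hm : 0 < m) (v w : V) (F : Finset (V × Fin δ)) :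
    unifProb (fun x : V → Fin δ → Fin m => F ⊆ hits v w x) ≤ (2 * δ / m : ℝ) ^ F.card := by
  by_cases hF : ∀ e ∈ F, e.1 ≠ v ∧ e.1 ≠ w
  · set C : Finset (V × Fin δ) := ({v, w} : Finset V) ×ˢ Finset.univ with hC
    have hCc : (C.card : ℝ) ≤ 2 * δ := by
      rw [hC, Finset.card_product, Finset.card_fin]
      exact_mod_cast Nat.mul_le_mul_right _ Finset.card_le_two
    have hdisj : Disjoint F C := by
      refine Finset.disjoint_left.2 fun e he hc => ?_
      simp only [hC, Finset.mem_product, Finset.mem_insert, Finset.mem_singleton] at hc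
      rcases hc.1 with h | h
      · exact (hF e he).1 h
      · exact (hF e he).2 h
    refine (unifProb_mono fun x hx => ?_).trans
      ((unifProb_forall_exists_eq_le hm F C hdisj).trans ?_)
    · intro e he
      rcases (mem_hits.1 (hx he)).2 with h | h <;> obtain ⟨l, hl⟩ := mem_nb.1 h
      · exact ⟨(v, l), by simp [hC], hl.symm⟩
      · exact ⟨(w, l), by simp [hC], hl.symm⟩
    · gcongr
  · rw [unifProb_of_forall_not]
    · positivity
    · exact fun x hx => hF fun e he => (mem_hits.1 (hx he)).1

theorem card_le_of_mem_lines {Ω : Finset (V × V)} (hd : 1 ≤ d)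
    (hrow : ∀ v, (Finset.univ.filter fun w => (v, w) ∈ Ω).card ≤ d)
    (hcol : ∀ w, (Finset.univ.filter fun v => (v, w) ∈ Ω).card ≤ d) {W : Finset V}
    (hW : W ∈ lines Ω) : W.card ≤ d := by
  simp only [lines, Finset.mem_union, Finset.mem_image, Finset.mem_univ, true_and] at hW
  rcases hW with (⟨v, rfl⟩ | ⟨v, rfl⟩) | ⟨v, rfl⟩
  · exact hrow v
  · exact hcol v
  · simpa using hd

theorem card_lines_le (Ω : Finset (V × V)) : (lines Ω).card ≤ 3 * Fintype.card V := by
  have h : ∀ f : V → Finset V, (Finset.univ.image f).card ≤ Fintype.card V := fun f =>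
    Finset.card_image_le
  refine (Finset.card_union_le _ _).trans ?_
  have h1 := Finset.card_union_le
    (Finset.univ.image fun v => Finset.univ.filter fun w => (v, w) ∈ Ω)
    (Finset.univ.image fun w => Finset.univ.filter fun v => (v, w) ∈ Ω)
  have h2 := h fun v => Finset.univ.filter fun w => (v, w) ∈ Ω
  have h3 := h fun w => Finset.univ.filter fun v => (v, w) ∈ Ω
  have h4 := h fun v => {v}
  omega

theorem pow_le_rpow_div {ρ : ℝ} (h0 : 0 < ρ) (h1 : ρ ≤ 1) {t : ℕ} (ht : (δ : ℝ) / 64 ≤ t) :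
    ρ ^ t ≤ ρ ^ ((δ : ℝ) / 64) := by
  rw [← Real.rpow_natCast]
  exact Real.rpow_le_rpow_of_exponent_ge h0 h1 ht

theorem div_le_div_add_one (δ : ℕ) : (δ : ℝ) / 64 ≤ ((δ / 64 + 1 : ℕ) : ℝ) := by
  have h : δ ≤ 64 * (δ / 64 + 1) := by omega
  rw [div_le_iff₀ (by norm_num)]
  calc (δ : ℝ) ≤ ((64 * (δ / 64 + 1) : ℕ) : ℝ) := by exact_mod_cast h
    _ = _ := by push_cast; ring

variable {κ : ℝ}

/-- The hypothesis of `unifProb_exists_subset_le` for more than `δ / 64` bad draws among at most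
`d δ`, each bad with probability about `2 δ / m`. -/
theorem exp_one_mul_le (hm : 0 < m) (hκ : 0 < κ) (h1 : (d * δ : ℝ) ≤ κ * m) {n : ℕ}
    (hn : n ≤ d * δ) :
    Real.exp 1 * (n * (2 * δ / m)) ≤ 1536 * κ * ((δ / 64 + 1 : ℕ) : ℝ) := by
  have hm' : (0 : ℝ) < m := by exact_mod_cast hm
  have hn' : (n : ℝ) ≤ κ * m := le_trans (by exact_mod_cast hn) h1
  have h2 : (n * (2 * δ / m) : ℝ) ≤ 2 * κ * δ := by
    rw [← mul_div_assoc, div_le_iff₀ hm']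
    nlinarith [Nat.cast_nonneg (α := ℝ) δ]
  have h3 : Real.exp 1 ≤ 3 := by linarith [Real.exp_one_lt_d9]
  have h4 := div_le_div_add_one δ
  have h5 : (0 : ℝ) ≤ κ * δ := by positivity
  calc Real.exp 1 * (n * (2 * δ / m)) ≤ 3 * (2 * κ * δ) := by gcongr
    _ ≤ 1536 * κ * ((δ : ℝ) / 64) := by linarith
    _ ≤ _ := by gcongr

/-- Many repeated draws at one vertex are unlikely: the draws outside a set of representatives all
repeat a representative. -/
theorem unifProb_card_nb_lt_le (hm : 0 < m) (hd : 1 ≤ d) (hκ : 0 < κ) (hκ1 : 1536 * κ ≤ 1)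
    (h1 : (d * δ : ℝ) ≤ κ * m) (v : V) :
    unifProb (fun x : V → Fin δ → Fin m => ¬ (63 / 64 : ℝ) * δ ≤ ((nb x v).card : ℝ)) ≤
      (1536 * κ) ^ ((δ : ℝ) / 64) := by
  set Y : Finset (V × Fin δ) := {v} ×ˢ Finset.univ with hY
  have hYc : Y.card = δ := by simp [hY]
  refine (unifProb_mono fun x hx => ?_).trans ((unifProb_exists_subset_le Y (δ / 64 + 1)
    (Nat.succ_pos _) (q := 2 * δ / m) (by positivity)
    (exp_one_mul_le hm hκ h1 (hYc.trans_le (Nat.le_mul_of_pos_left δ hd)))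
    (fun F x => ∀ e ∈ F, ∃ c ∈ Y \ F, x e.1 e.2 = x c.1 c.2) fun F hF hFc => ?_).trans
    (pow_le_rpow_div (by positivity) hκ1 (div_le_div_add_one δ)))
  · obtain ⟨S, -, hinj, hS⟩ := Finset.exists_subset_injOn_image_eq_of_surjOn (f := x v) Set.univ
      (nb x v) fun a ha => by
        obtain ⟨l, hl⟩ := mem_nb.1 (Finset.mem_coe.1 ha)
        exact ⟨l, trivial, hl⟩
    have hScard : S.card = (nb x v).card := by
      rw [← hS, Finset.card_image_of_injOn hinj]
    have hlt : δ / 64 + 1 ≤ ((({v} : Finset V) ×ˢ Sᶜ)).card := by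
      rw [Finset.card_product, Finset.card_singleton, one_mul, Finset.card_compl,
        Fintype.card_fin, hScard]
      rw [not_le] at hx
      have : 64 * (nb x v).card < 63 * δ := by
        have : 64 * ((nb x v).card : ℝ) < 63 * δ := by linarith
        exact_mod_cast this
      omega
    obtain ⟨F, hF, hFc⟩ := Finset.exists_subset_card_eq hlt
    refine ⟨F, hF.trans (Finset.product_subset_product_right (Finset.subset_univ _)), hFc, ?_⟩
    rintro ⟨k, l⟩ he
    have he' := Finset.mem_product.1 (hF he)
    have hk : k = v := Finset.mem_singleton.1 he'.1
    subst hk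
    have : x k l ∈ Finset.image (x k) S := by
      rw [hS]; exact mem_nb.2 ⟨l, rfl⟩
    obtain ⟨l', hl', h⟩ := Finset.mem_image.1 this
    refine ⟨(k, l'), ?_, h.symm⟩
    simp only [hY, Finset.mem_sdiff, Finset.mem_product, Finset.mem_singleton, Finset.mem_univ,
      and_self, true_and]
    intro h'
    exact Finset.mem_compl.1 (Finset.mem_product.1 (hF h')).2 hl'
  · refine (unifProb_forall_exists_eq_le hm F (Y \ F) Finset.disjoint_sdiff).trans ?_
    rw [hFc]
    have : (((Y \ F).card : ℕ) : ℝ) ≤ 2 * δ := by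
      have := (Finset.card_le_card (Finset.sdiff_subset (s := Y) (t := F))).trans_eq hYc
      have h2 : ((Y \ F).card : ℝ) ≤ δ := by exact_mod_cast this
      linarith [Nat.cast_nonneg (α := ℝ) δ]
    gcongr

theorem unifProb_hits_line_lt_le (hm : 0 < m) (hκ : 0 < κ) (hκ1 : 1536 * κ ≤ 1)
    (h1 : (d * δ : ℝ) ≤ κ * m) (v w : V) {W : Finset V} (hW : W.card ≤ d) :
    unifProb (fun x : V → Fin δ → Fin m =>
      ¬ (((hits v w x).filter fun e => e.1 ∈ W).card : ℝ) ≤ (1 / 64 : ℝ) * δ) ≤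
      (1536 * κ) ^ ((δ : ℝ) / 64) := by
  set Y : Finset (V × Fin δ) := W ×ˢ Finset.univ with hY
  have hYc : Y.card ≤ d * δ := by
    rw [hY, Finset.card_product, Finset.card_fin]
    exact Nat.mul_le_mul_right _ hW
  refine (unifProb_mono fun x hx => ?_).trans ((unifProb_exists_subset_le Y (δ / 64 + 1)
    (Nat.succ_pos _) (q := 2 * δ / m) (by positivity) (exp_one_mul_le hm hκ h1 hYc)
    (fun F x => F ⊆ hits v w x) fun F hF hFc => ?_).trans
    (pow_le_rpow_div (by positivity) hκ1 (div_le_div_add_one δ)))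
  · have hlt : δ / 64 + 1 ≤ ((hits v w x).filter fun e => e.1 ∈ W).card := by
      rw [not_le] at hx
      have : δ < 64 * ((hits v w x).filter fun e => e.1 ∈ W).card := by
        have : (δ : ℝ) < 64 * (((hits v w x).filter fun e => e.1 ∈ W).card : ℝ) := by linarith
        exact_mod_cast this
      omega
    obtain ⟨F, hF, hFc⟩ := Finset.exists_subset_card_eq hlt
    refine ⟨F, fun e he => ?_, hFc, hF.trans (Finset.filter_subset _ _)⟩
    simp [hY, (Finset.mem_filter.1 (hF he)).2]
  · exact hFc ▸ unifProb_subset_hits_le hm v w F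

theorem card_drawPairs_fst_le {Ω : Finset (V × V)}
    (hrow : ∀ v, (Finset.univ.filter fun w => (v, w) ∈ Ω).card ≤ d) (e : V × Fin δ) :
    ((drawPairs δ Ω).filter fun r => r.1 = e).card ≤ d * δ := by
  calc _ ≤ ((Finset.univ.filter fun w => (e.1, w) ∈ Ω) ×ˢ (Finset.univ : Finset (Fin δ))).card := by
        refine Finset.card_le_card_of_injOn (fun r => r.2) (fun r hr => ?_) fun r hr r' hr' h => ?_
        · simp only [drawPairs, Finset.coe_filter, Finset.mem_filter, Finset.mem_univ, true_and,
            Set.mem_ofPred_eq] at hr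
          simp only [Finset.coe_product, Finset.coe_filter, Set.mem_prod, Finset.coe_univ,
            Set.mem_univ, and_true, Finset.mem_univ, true_and, Set.mem_ofPred_eq]
          rw [← hr.2]
          exact hr.1.1
        · simp only [Finset.coe_filter, Set.mem_ofPred_eq] at hr hr'
          exact Prod.ext (hr.2.trans hr'.2.symm) h
    _ ≤ d * δ := by
        rw [Finset.card_product, Finset.card_fin]
        exact Nat.mul_le_mul_right _ (hrow _)

theorem card_drawPairs_le {Ω : Finset (V × V)}
    (hrow : ∀ v, (Finset.univ.filter fun w => (v, w) ∈ Ω).card ≤ d) :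
    (drawPairs δ Ω).card ≤ Fintype.card V * δ * (d * δ) := by
  calc _ ≤ ((Finset.univ : Finset (V × Fin δ)).biUnion fun e =>
        (drawPairs δ Ω).filter fun r => r.1 = e).card := by
        refine Finset.card_le_card fun r hr => ?_
        simp [hr]
    _ ≤ (Finset.univ : Finset (V × Fin δ)).card * (d * δ) :=
        Finset.card_biUnion_le_card_mul _ _ _ fun e _ => card_drawPairs_fst_le hrow e
    _ = _ := by simp

theorem unifProb_hits_pair_lt_le (hm : 0 < m) (hδ : 0 < δ) {Ω : Finset (V × V)}
    (hrow : ∀ v, (Finset.univ.filter fun w => (v, w) ∈ Ω).card ≤ d)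
    (hκ : 0 < κ) (hκ1 : 1536 * κ ≤ 1) (h1 : (d * δ : ℝ) ≤ κ * m)
    (h2 : (Fintype.card V * d * δ ^ 2 : ℝ) ≤ 2 * κ ^ 2 * m ^ 2) (v w : V) :
    unifProb (fun x : V → Fin δ → Fin m =>
      (∀ W ∈ lines Ω, (((hits v w x).filter fun e => e.1 ∈ W).card : ℝ) ≤ (1 / 64 : ℝ) * δ) ∧
      ¬ (((drawPairs δ Ω).filter fun r => r.1 ∈ hits v w x ∧ r.2 ∈ hits v w x).card : ℝ) ≤
        (1 / 64 : ℝ) * (δ : ℝ) ^ 2) ≤ (1536 * κ) ^ ((δ : ℝ) / 64) := by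
  have hm' : (0 : ℝ) < m := by exact_mod_cast hm
  have hδ' : (0 : ℝ) < δ := by exact_mod_cast hδ
  -- sequences of length about `δ / 4` use up at most half of the pairs
  obtain ⟨s, N, hs, hN, hsδ⟩ : ∃ s N : ℕ, 2 * s ≤ N + 2 ∧ 2 * N ≤ δ ∧ δ ≤ 64 * s :=
    ⟨(δ + 3) / 4, 2 * ((δ + 3) / 4) - 2, by omega, by omega, by omega⟩
  have hN' : (N : ℝ) ≤ δ / 2 := by
    have : (2 * N : ℝ) ≤ δ := by exact_mod_cast hN
    linarith
  have hNτ : (N : ℝ) * (1 / 64 * δ) ≤ 1 / 128 * (δ : ℝ) ^ 2 := by nlinarith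
  have hRc : ((drawPairs δ Ω).card : ℝ) ≤ Fintype.card V * δ * (d * δ) := by
    exact_mod_cast card_drawPairs_le hrow
  refine (unifProb_mono fun x hx => ?_).trans ((unifProb_pairCount_le (hits v w) (drawPairs δ Ω)
    (fun r hr => (Finset.mem_filter.1 hr).2.2) (q := 2 * δ / m) (by positivity)
    (unifProb_subset_hits_le hm v w) (D := d * δ) (N := N) (card_drawPairs_fst_le hrow)
    (T := 1 / 64 * (δ : ℝ) ^ 2) (τ := 1 / 64 * δ) (b := 1536 * κ) (by positivity)
    (by nlinarith) hs ?_).trans (pow_le_rpow_div (by positivity) hκ1 ?_))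
  · refine ⟨fun e => ?_, (not_le.1 hx.2).le⟩
    have hW : (Finset.univ.filter fun k => (k, e.1) ∈ Ω) ∈ lines Ω := by simp [lines]
    refine le_trans ?_ (hx.1 _ hW)
    norm_cast
    refine Finset.card_le_card_of_injOn (fun r => r.1) (fun r hr => ?_) fun r hr r' hr' h => ?_
    · simp only [drawPairs, Finset.coe_filter, Finset.mem_filter, Finset.mem_univ, true_and,
        Set.mem_ofPred_eq] at hr ⊢
      refine ⟨hr.2.2, ?_⟩
      rw [← hr.2.1]
      exact hr.1.1
    · simp only [Finset.coe_filter, Set.mem_ofPred_eq] at hr hr'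
      exact Prod.ext h (hr.2.1.trans hr'.2.1.symm)
  · have e1 : ((drawPairs δ Ω).card : ℝ) * (2 * δ / m) ^ 2 ≤ 8 * κ * (δ : ℝ) ^ 2 := by
      calc ((drawPairs δ Ω).card : ℝ) * (2 * δ / m) ^ 2
          ≤ (Fintype.card V * δ * (d * δ)) * (2 * δ / m) ^ 2 := by gcongr
        _ = (Fintype.card V * d * δ ^ 2) * (4 * (δ : ℝ) ^ 2 / m ^ 2) := by
          rw [div_pow]; ring
        _ ≤ (2 * κ ^ 2 * m ^ 2) * (4 * (δ : ℝ) ^ 2 / m ^ 2) := by gcongr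
        _ = 8 * (κ * κ) * (δ : ℝ) ^ 2 := by field_simp; ring
        _ ≤ 8 * κ * (δ : ℝ) ^ 2 := by
          have : κ * κ ≤ κ := by nlinarith
          gcongr
    have e2 : (N : ℝ) * ((d * δ : ℕ) : ℝ) * (2 * δ / m) ≤ κ * (δ : ℝ) ^ 2 := by
      push_cast
      calc (N : ℝ) * (d * δ) * (2 * δ / m) ≤ (δ / 2) * (κ * m) * (2 * δ / m) := by gcongr
        _ = κ * (δ : ℝ) ^ 2 := by field_simp
    have e3 : 1536 * κ * (1 / 128 * (δ : ℝ) ^ 2) ≤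
        1536 * κ * (1 / 64 * (δ : ℝ) ^ 2 - N * (1 / 64 * δ)) := by
      gcongr
      linarith
    have e4 : 0 ≤ κ * (δ : ℝ) ^ 2 := by positivity
    linarith
  · rw [div_le_iff₀ (by norm_num)]
    exact_mod_cast hsδ.trans_eq (mul_comm _ _)

theorem unifProb_exists_not_disjoint_le (hm : 0 < m) :
    unifProb (fun x : V → Fin δ → Fin m => ∃ v w, v ≠ w ∧ ¬ Disjoint (nb x v) (nb x w)) ≤
      (Fintype.card V * δ : ℝ) ^ 2 / m := by
  set s : Finset ((V × Fin δ) × (V × Fin δ)) := Finset.univ.filter fun r => r.1 ≠ r.2 with hs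
  refine (unifProb_mono fun x hx => ?_).trans
    ((unifProb_exists_mem_le_of_le s (fun r x => x r.1.1 r.1.2 = x r.2.1 r.2.2)
      (b := 1 / m) fun r hr => ?_).trans ?_)
  · obtain ⟨v, w, hvw, h⟩ := hx
    obtain ⟨a, ha, hb⟩ := Finset.not_disjoint_iff.1 h
    obtain ⟨l, hl⟩ := mem_nb.1 ha
    obtain ⟨l', hl'⟩ := mem_nb.1 hb
    refine ⟨((v, l), (w, l')), ?_, hl.trans hl'.symm⟩
    simp [hs, hvw]
  · have h := unifProb_forall_exists_eq_le hm {r.1} {r.2}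
      (Finset.disjoint_singleton.2 (Finset.mem_filter.1 hr).2)
    simpa using h
  · have hsc : (s.card : ℝ) ≤ (Fintype.card V * δ : ℝ) ^ 2 := by
      have h := Finset.card_filter_le (Finset.univ : Finset ((V × Fin δ) × (V × Fin δ)))
        fun r => r.1 ≠ r.2
      rw [Finset.card_univ, Fintype.card_prod, Fintype.card_prod, Fintype.card_fin, ← pow_two] at h
      exact_mod_cast h
    rw [mul_one_div]
    gcongr

theorem unifProb_not_wellSpread_le (hm : 0 < m) (hδ : 0 < δ) (hd : 1 ≤ d) {Ω : Finset (V × V)}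
    (hrow : ∀ v, (Finset.univ.filter fun w => (v, w) ∈ Ω).card ≤ d)
    (hcol : ∀ w, (Finset.univ.filter fun v => (v, w) ∈ Ω).card ≤ d)
    (hκ : 0 < κ) (hκ1 : 1536 * κ ≤ 1) (h1 : (d * δ : ℝ) ≤ κ * m)
    (h2 : (Fintype.card V * d * δ ^ 2 : ℝ) ≤ 2 * κ ^ 2 * m ^ 2) {B : ℝ} (hB0 : 0 ≤ B)
    (hB : δ < 64 → (Fintype.card V * δ : ℝ) ^ 2 / m ≤ B) :
    unifProb (fun x : V → Fin δ → Fin m => ¬ WellSpread Ω x) ≤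
      5 * (Fintype.card V : ℝ) ^ 3 * (1536 * κ) ^ ((δ : ℝ) / 64) + B := by
  set b := (1536 * κ) ^ ((δ : ℝ) / 64) with hb
  have hb0 : 0 ≤ b := by positivity
  set n := Fintype.card V with hn
  have pa := unifProb_exists_mem_le_of_le (Finset.univ : Finset V)
    (fun v (x : V → Fin δ → Fin m) => ¬ (63 / 64 : ℝ) * δ ≤ ((nb x v).card : ℝ))
    fun v _ => unifProb_card_nb_lt_le hm hd hκ hκ1 h1 v
  have pw := unifProb_exists_mem_le_of_le ((Finset.univ : Finset (V × V)) ×ˢ lines Ω)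
    (fun i (x : V → Fin δ → Fin m) =>
      ¬ (((hits i.1.1 i.1.2 x).filter fun e => e.1 ∈ i.2).card : ℝ) ≤ (1 / 64 : ℝ) * δ)
    fun i hi => unifProb_hits_line_lt_le hm hκ hκ1 h1 i.1.1 i.1.2
      (card_le_of_mem_lines hd hrow hcol (Finset.mem_product.1 hi).2)
  have pc := unifProb_exists_mem_le_of_le (Finset.univ : Finset (V × V))
    (fun i (x : V → Fin δ → Fin m) => (∀ W ∈ lines Ω,
        (((hits i.1 i.2 x).filter fun e => e.1 ∈ W).card : ℝ) ≤ (1 / 64 : ℝ) * δ) ∧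
      ¬ (((drawPairs δ Ω).filter fun r => r.1 ∈ hits i.1 i.2 x ∧ r.2 ∈ hits i.1 i.2 x).card : ℝ) ≤
        (1 / 64 : ℝ) * (δ : ℝ) ^ 2)
    fun i _ => unifProb_hits_pair_lt_le hm hδ hrow hκ hκ1 h1 h2 i.1 i.2
  have pd : unifProb (fun x : V → Fin δ → Fin m =>
      δ < 64 ∧ ∃ v w, v ≠ w ∧ ¬ Disjoint (nb x v) (nb x w)) ≤ B := by
    by_cases h : δ < 64
    · exact (unifProb_mono fun x hx => hx.2).trans
        ((unifProb_exists_not_disjoint_le hm).trans (hB h))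
    · rw [unifProb_of_forall_not fun x hx => h hx.1]
      exact hB0
  have hcover := (unifProb_mono fun (x : V → Fin δ → Fin m) (hx : ¬ WellSpread Ω x) =>
    show _ ∨ _ ∨ _ ∨ _ from by
      by_contra hcon
      simp only [not_or] at hcon
      obtain ⟨ca, cw, cc, cd⟩ := hcon
      have cw' : ∀ v w, ∀ W ∈ lines Ω,
          (((hits v w x).filter fun e => e.1 ∈ W).card : ℝ) ≤ (1 / 64 : ℝ) * δ :=
        fun v w W hW => by_contra fun h => cw ⟨((v, w), W), by simp [hW], h⟩
      refine hx ⟨fun v => by_contra fun h => ca ⟨v, by simp, h⟩, cw',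
        fun v w => by_contra fun h => cc ⟨(v, w), by simp, cw' v w, h⟩, fun h v w hvw =>
          by_contra fun h' => cd ⟨h, v, w, hvw, h'⟩⟩).trans
    ((unifProb_or_le _ _).trans (add_le_add pa ((unifProb_or_le _ _).trans (add_le_add pw
      ((unifProb_or_le _ _).trans (add_le_add pc pd))))))
  refine hcover.trans ?_
  have hl : ((lines Ω).card : ℝ) ≤ 3 * n := by exact_mod_cast card_lines_le Ω
  have n1 : (n : ℝ) ≤ (n : ℝ) ^ 3 := by exact_mod_cast Nat.le_self_pow (by norm_num) n
  have n2 : (n * n : ℝ) ≤ (n : ℝ) ^ 3 := by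
    have h : n * n * 1 ≤ n * n * n := by
      rcases Nat.eq_zero_or_pos n with h | h
      · simp [h]
      · exact Nat.mul_le_mul_left _ h
    rw [mul_one, ← pow_three'] at h
    exact_mod_cast h
  have n3 : (n * n * (lines Ω).card : ℝ) ≤ 3 * (n : ℝ) ^ 3 := by
    calc (n * n * (lines Ω).card : ℝ) ≤ n * n * (3 * n) := by gcongr
      _ = _ := by ring
  simp only [Finset.card_product, Finset.card_univ, Fintype.card_prod, ← hn, Nat.cast_mul]
  have m1 := mul_le_mul_of_nonneg_right n1 hb0
  have m2 := mul_le_mul_of_nonneg_right n2 hb0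
  have m3 := mul_le_mul_of_nonneg_right n3 hb0
  linarith

end Probability

/-! ### The law of the trials -/

section Law

theorem real_setOf_eq_unifProb {X : Type*} [Fintype X] [MeasurableSpace X]
    [MeasurableSingletonClass X] (μ : Measure X) [SigmaFinite μ]
    (h : ∀ x, μ.real {x} = (Fintype.card X : ℝ)⁻¹) (P : X → Prop) :
    μ.real {x | P x} = unifProb P := by
  classical
  have h1 : ({x | P x} : Set X) = ((Finset.univ.filter P : Finset X) : Set X) := by simp
  rw [unifProb_eq_ncard_div, h1, ← sum_measureReal_singleton, Set.ncard_coe_finset]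
  simp [h, div_eq_mul_inv]

theorem trialLaw_real_singleton {p m δ : ℕ} (x : Fin p → Fin δ → Fin m) :
    (trialLaw p m δ).real {x} = (Fintype.card (Fin p → Fin δ → Fin m) : ℝ)⁻¹ := by
  rw [trialLaw, measureReal_def, Measure.pi_singleton]
  simp [Measure.pi_singleton, uniformOn_univ]

instance sigmaFinite_trialLaw {p m δ : ℕ} : SigmaFinite (trialLaw p m δ) := by
  unfold trialLaw; infer_instance

theorem trialLaw_real_eq {p m δ : ℕ} (P : (Fin p → Fin δ → Fin m) → Prop) :
    (trialLaw p m δ).real {x | P x} = unifProb P :=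
  real_setOf_eq_unifProb _ trialLaw_real_singleton P

theorem unifProb_comp_equiv {X Y : Type*} [Fintype X] [Fintype Y] (e : X ≃ Y) (P : Y → Prop) :
    unifProb (fun x => P (e x)) = unifProb P := by
  classical
  exact Fintype.expect_equiv e _ _ fun x => rfl

/-- Two independent families of trials form a single family on the disjoint union of the left
vertices. -/
theorem trialLaw_prod_real_eq {p m δ : ℕ}
    (P : (Fin p → Fin δ → Fin m) → (Fin p → Fin δ → Fin m) → Prop) :
    ((trialLaw p m δ).prod (trialLaw p m δ)).real {x | P x.1 x.2} =
      unifProb fun x : Fin p ⊕ Fin p → Fin δ → Fin m => P (x ∘ Sum.inl) (x ∘ Sum.inr) := by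
  rw [real_setOf_eq_unifProb]
  · rw [← unifProb_comp_equiv (Equiv.sumArrowEquivProdArrow (Fin p) (Fin p) (Fin δ → Fin m))]
    rfl
  · rintro ⟨x, y⟩
    rw [← Set.singleton_prod_singleton, measureReal_prod_prod, trialLaw_real_singleton,
      trialLaw_real_singleton, Fintype.card_prod, Nat.cast_mul, mul_inv]

end Law

theorem weakDistributedExpansion_zero {p m : ℕ} (x y : Fin p → Fin 0 → Fin m)
    (S : Set (Fin p × Fin p)) (ε : ℝ) :
    WeakDistributedExpansion ((BipartiteGraph.ofTrials x).tensor (BipartiteGraph.ofTrials y))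
      S 0 ε := by
  have h : ∀ T, ((BipartiteGraph.ofTrials x).tensor (BipartiteGraph.ofTrials y)).nbhd T = ∅ := by
    intro T
    ext c
    simp [BipartiteGraph.nbhd, BipartiteGraph.tensor, BipartiteGraph.ofTrials]
  constructor <;> simp [h]

/-! ### Choice of constants -/

/-- The constant `K` of the expansion lemma. -/
noncomputable def densityConst (C₁ C₂ : ℝ) : ℝ := (1536 * C₂ + 131072) * Real.exp (960 / C₁)

/-- With probability more than `1 - p⁻¹` the tensor graph expands. The maps `f` and `g` place the
left vertices of the two graphs in one set `V` of trial vertices: they are equal when the graphs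
coincide, and have disjoint ranges when the graphs are independent. -/
theorem lt_unifProb_weakDistributedExpansion {V : Type*} [Fintype V] [DecidableEq V]
    {p d m δ : ℕ} (hV : Fintype.card V ≤ 2 * p) {f g : Fin p → V} (hf : f.Injective)
    (hg : g.Injective) {C₁ C₂ : ℝ} (hC₁ : 0 < C₁) (hC : C₁ ≤ C₂) {S : Set (Fin p × Fin p)}
    (hp : 1 ≤ p) (hS : IsDistributed d S) (hδ₁ : C₁ * Real.log p ≤ δ) (hδ₂ : δ ≤ C₂ * Real.log p)
    (hm : densityConst C₁ C₂ * (Real.sqrt (d * p) * Real.log p) ≤ m) :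
    1 - (p : ℝ) ^ (-1 : ℝ) < unifProb fun x : V → Fin δ → Fin m =>
      WeakDistributedExpansion ((BipartiteGraph.ofTrials (x ∘ f)).tensor
        (BipartiteGraph.ofTrials (x ∘ g))) S δ (1 / 8) := by
  classical
  rw [Real.rpow_neg_one]
  rcases hp.eq_or_lt with rfl | hp2
  · have hδ0 : δ = 0 := by simpa using hδ₂
    subst hδ0
    simp [weakDistributedExpansion_zero, unifProb]
  have hC₂ : 0 < C₂ := hC₁.trans_le hC
  set L := Real.log p with hL
  have hp' : (2 : ℝ) ≤ p := by exact_mod_cast hp2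
  have hp0 : (0 : ℝ) < p := by linarith
  have hL2 : 1 / 2 ≤ L := by
    have := Real.log_le_log (by norm_num) hp'
    linarith [Real.log_two_gt_d9]
  have hL0 : 0 < L := by linarith
  have hδ' : (0 : ℝ) < δ := (mul_pos hC₁ hL0).trans_le hδ₁
  have hδ : 0 < δ := by exact_mod_cast hδ'
  set A := Real.exp (960 / C₁) with hA
  have hA1 : 1 ≤ A := Real.one_le_exp (by positivity)
  set K := densityConst C₁ C₂ with hK
  have hKdef : K = (1536 * C₂ + 131072) * A := rfl
  have hK0 : 0 < K := by rw [hKdef]; positivity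
  have hd : 1 ≤ d := by
    refine le_trans ((Set.ncard_pos (Set.toFinite _)).2 ?_) (hS.2 ⟨0, hp⟩).1
    exact ⟨_, hS.1 _, rfl⟩
  -- lines of `S` have at most `min d p` points
  set d' := min d p with hd'
  have hd'1 : 1 ≤ d' := le_min hd hp
  have hd'p : (d' : ℝ) ≤ p := by exact_mod_cast min_le_right d p
  have hd'd : (d' : ℝ) ≤ d := by exact_mod_cast min_le_left d p
  have hd'1' : (1 : ℝ) ≤ d' := by exact_mod_cast hd'1
  set Q := Real.sqrt (d' * p) with hQ
  have hQ1 : 1 ≤ Q := Real.one_le_sqrt.2 (by nlinarith)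
  have hQm : K * (Q * L) ≤ m := by
    refine le_trans ?_ hm
    have : Q ≤ Real.sqrt (d * p) := Real.sqrt_le_sqrt (by gcongr)
    gcongr
  have hKLm : K / 2 ≤ m := by
    have h : 1 * (1 / 2) ≤ Q * L := mul_le_mul hQ1 hL2 (by norm_num) (by linarith)
    calc K / 2 = K * (1 * (1 / 2)) := by ring
      _ ≤ K * (Q * L) := by gcongr
      _ ≤ m := hQm
  have hm' : (0 : ℝ) < m := lt_of_lt_of_le (by positivity) hKLm
  have hm0 : 0 < m := by exact_mod_cast hm'
  set κ := C₂ / K with hκ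
  have hκ0 : 0 < κ := by positivity
  have hκA : 1536 * κ ≤ A⁻¹ := by
    rw [hκ, ← mul_div_assoc, div_le_iff₀ hK0, hKdef]
    field_simp
    linarith
  have hκ1 : 1536 * κ ≤ 1 := hκA.trans (inv_le_one_of_one_le₀ hA1)
  have hκm : Q * δ ≤ κ * m := by
    calc Q * δ ≤ Q * (C₂ * L) := by gcongr
      _ = κ * (K * (Q * L)) := by rw [hκ]; field_simp
      _ ≤ κ * m := by gcongr
  have hsq : (d' * p * δ ^ 2 : ℝ) ≤ κ ^ 2 * m ^ 2 := by
    have h := pow_le_pow_left₀ (by positivity) hκm 2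
    rwa [mul_pow, mul_pow, hQ, Real.sq_sqrt (by positivity)] at h
  have h1 : (d' * δ : ℝ) ≤ κ * m := by
    refine le_trans ?_ hκm
    gcongr
    exact Real.le_sqrt_of_sq_le (by nlinarith)
  have hV' : (Fintype.card V : ℝ) ≤ 2 * p := by exact_mod_cast hV
  have h2 : (Fintype.card V * d' * δ ^ 2 : ℝ) ≤ 2 * κ ^ 2 * m ^ 2 := by
    calc (Fintype.card V * d' * δ ^ 2 : ℝ) ≤ 2 * p * d' * δ ^ 2 := by gcongr
      _ = 2 * (d' * p * δ ^ 2) := by ring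
      _ ≤ 2 * (κ ^ 2 * m ^ 2) := by gcongr
      _ = _ := by ring
  set Ω : Finset (V × V) := Finset.univ.filter fun k => ∃ s ∈ S, Prod.map f g s = k with hΩ
  have hΩ' : ∀ k, k ∈ Ω ↔ ∃ s ∈ S, Prod.map f g s = k := fun k => by simp [hΩ]
  have hrow : ∀ v, (Finset.univ.filter fun w => (v, w) ∈ Ω).card ≤ d' := by
    intro v
    by_cases hv : ∃ i, f i = v
    · obtain ⟨i, rfl⟩ := hv
      have hsub : (Finset.univ.filter fun w => (f i, w) ∈ Ω) ⊆
          (Finset.univ.filter fun j => (i, j) ∈ S).image g := by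
        intro w hw
        simp only [Finset.mem_filter, Finset.mem_univ, true_and, hΩ'] at hw
        obtain ⟨⟨a, b⟩, hs, h⟩ := hw
        obtain ⟨ha, hb⟩ := Prod.mk.inj h
        have := hf ha
        subst this
        exact Finset.mem_image.2 ⟨b, by simpa using hs, hb⟩
      refine (Finset.card_le_card hsub).trans (Finset.card_image_le.trans (le_min ?_ ?_))
      · refine le_trans ?_ (hS.2 i).1
        rw [← Set.ncard_coe_finset]
        refine Set.ncard_le_ncard_of_injOn (fun j => (i, j)) (fun j hj => ?_)
          (fun a _ b _ h => (Prod.mk.inj h).2) (Set.toFinite _)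
        exact ⟨by simpa using hj, rfl⟩
      · simpa using Finset.card_filter_le (Finset.univ : Finset (Fin p)) fun j => (i, j) ∈ S
    · rw [Finset.filter_false_of_mem]
      · simp
      · intro w _ hw
        obtain ⟨s, -, h⟩ := (hΩ' _).1 hw
        exact hv ⟨s.1, (Prod.mk.inj h).1⟩
  have hcol : ∀ w, (Finset.univ.filter fun v => (v, w) ∈ Ω).card ≤ d' := by
    intro w
    by_cases hw : ∃ j, g j = w
    · obtain ⟨j, rfl⟩ := hw
      have hsub : (Finset.univ.filter fun v => (v, g j) ∈ Ω) ⊆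
          (Finset.univ.filter fun i => (i, j) ∈ S).image f := by
        intro v hv
        simp only [Finset.mem_filter, Finset.mem_univ, true_and, hΩ'] at hv
        obtain ⟨⟨a, b⟩, hs, h⟩ := hv
        obtain ⟨ha, hb⟩ := Prod.mk.inj h
        have := hg hb
        subst this
        exact Finset.mem_image.2 ⟨a, by simpa using hs, ha⟩
      refine (Finset.card_le_card hsub).trans (Finset.card_image_le.trans (le_min ?_ ?_))
      · refine le_trans ?_ (hS.2 j).2
        rw [← Set.ncard_coe_finset]
        refine Set.ncard_le_ncard_of_injOn (fun i => (i, j)) (fun i hi => ?_)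
          (fun a _ b _ h => (Prod.mk.inj h).1) (Set.toFinite _)
        exact ⟨by simpa using hi, rfl⟩
      · simpa using Finset.card_filter_le (Finset.univ : Finset (Fin p)) fun i => (i, j) ∈ S
    · rw [Finset.filter_false_of_mem]
      · simp
      · intro v _ hv
        obtain ⟨s, -, h⟩ := (hΩ' _).1 hv
        exact hw ⟨s.2, (Prod.mk.inj h).2⟩
  -- `δ < 64` bounds `p`, and then `m` is large enough to make every collision unlikely
  have hB : δ < 64 → (Fintype.card V * δ : ℝ) ^ 2 / m ≤ 1 / (4 * p) := by
    intro h64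
    have h64' : (δ : ℝ) ≤ 64 := by exact_mod_cast h64.le
    have hLle : L ≤ 64 / C₁ := by
      rw [le_div_iff₀ hC₁]; linarith
    have hp3 : (p : ℝ) ^ 3 ≤ A := by
      calc (p : ℝ) ^ 3 = Real.exp L ^ 3 := by rw [hL, Real.exp_log hp0]
        _ = Real.exp (3 * L) := by rw [← Real.exp_nat_mul]; norm_num
        _ ≤ A := by
          refine Real.exp_le_exp.2 ?_
          have h960 : (960 : ℝ) / C₁ = 15 * (64 / C₁) := by ring
          have : 0 < 64 / C₁ := by positivity
          linarith
    have hmA : 65536 * A ≤ m := by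
      refine le_trans ?_ hKLm
      rw [hKdef]
      nlinarith
    rw [div_le_div_iff₀ hm' (by positivity)]
    calc (Fintype.card V * δ : ℝ) ^ 2 * (4 * p) ≤ (2 * p * 64) ^ 2 * (4 * p) := by gcongr
      _ = 65536 * (p : ℝ) ^ 3 := by ring
      _ ≤ 65536 * A := by gcongr
      _ ≤ 1 * m := by linarith
  have hbad := unifProb_not_wellSpread_le hm0 hδ hd'1 hrow hcol hκ0 hκ1 h1 h2 (by positivity) hB
  have htail : (1536 * κ) ^ ((δ : ℝ) / 64) ≤ ((p : ℝ) ^ 15)⁻¹ := by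
    calc (1536 * κ) ^ ((δ : ℝ) / 64) ≤ (A⁻¹) ^ ((δ : ℝ) / 64) :=
          Real.rpow_le_rpow (by positivity) hκA (by positivity)
      _ = Real.exp (-(15 * (δ / C₁))) := by
          rw [hA, ← Real.exp_neg, ← Real.exp_mul]; congr 1; field_simp; norm_num
      _ ≤ Real.exp (-(15 * L)) := by
          have : L ≤ δ / C₁ := by rw [le_div_iff₀ hC₁]; linarith
          exact Real.exp_le_exp.2 (by linarith)
      _ = ((p : ℝ) ^ 15)⁻¹ := by
          rw [Real.exp_neg, mul_comm, hL, Real.exp_mul, Real.exp_log hp0]; norm_cast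
  have hlt : 5 * (Fintype.card V : ℝ) ^ 3 * (1536 * κ) ^ ((δ : ℝ) / 64) + 1 / (4 * p) <
      (p : ℝ)⁻¹ := by
    have h11 : (2 : ℝ) ^ 11 ≤ (p : ℝ) ^ 11 := pow_le_pow_left₀ (by norm_num) hp' 11
    calc 5 * (Fintype.card V : ℝ) ^ 3 * (1536 * κ) ^ ((δ : ℝ) / 64) + 1 / (4 * p)
        ≤ 5 * (2 * p : ℝ) ^ 3 * ((p : ℝ) ^ 15)⁻¹ + 1 / (4 * p) := by gcongr
      _ = (40 / (p : ℝ) ^ 11 + 1 / 4) * (p : ℝ)⁻¹ := by field_simp; ring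
      _ < 1 * (p : ℝ)⁻¹ := by
        have : 40 / (p : ℝ) ^ 11 < 3 / 4 := by
          rw [div_lt_iff₀ (by positivity)]; linarith
        gcongr
        linarith
      _ = _ := one_mul _
  have : Nonempty (Fin m) := ⟨⟨0, hm0⟩⟩
  rw [unifProb_not] at hbad
  have hmono : unifProb (fun x : V → Fin δ → Fin m => WellSpread Ω x) ≤ unifProb _ :=
    unifProb_mono fun x hx => hx.weakDistributedExpansion hf hg S hS.1 hΩ'
  linarith

theorem mainTheorem2 :
    ∃ ε : ℝ, 0 < ε ∧ ε < 1 / 4 ∧ ∃ c : ℝ, 0 < c ∧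
      ∀ C₁ C₂ : ℝ, 0 < C₁ → C₁ ≤ C₂ → ∃ K : ℝ, 0 < K ∧
        ∀ (p d m δ : ℕ) (Ω : Set (Fin p × Fin p)), 1 ≤ p → IsDistributed d Ω →
          C₁ * Real.log (p : ℝ) ≤ (δ : ℝ) → (δ : ℝ) ≤ C₂ * Real.log (p : ℝ) →
          K * (Real.sqrt ((d : ℝ) * (p : ℝ)) * Real.log (p : ℝ)) ≤ (m : ℝ) →
            1 - (p : ℝ) ^ (-c) <
                ((trialLaw p m δ).prod (trialLaw p m δ)).real
                  {x | WeakDistributedExpansion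
                    ((BipartiteGraph.ofTrials x.1).tensor (BipartiteGraph.ofTrials x.2)) Ω δ ε} ∧
            1 - (p : ℝ) ^ (-c) <
                (trialLaw p m δ).real
                  {x | WeakDistributedExpansion
                    ((BipartiteGraph.ofTrials x).tensor (BipartiteGraph.ofTrials x)) Ω δ ε} := by
  refine ⟨1 / 8, by norm_num, by norm_num, 1, one_pos, fun C₁ C₂ hC₁ hC =>
    ⟨densityConst C₁ C₂, ?_, fun p d m δ Ω hp hΩ hδ₁ hδ₂ hm => ⟨?_, ?_⟩⟩⟩
  · have : 0 < C₂ := hC₁.trans_le hC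
    unfold densityConst
    positivity
  · rw [trialLaw_prod_real_eq fun x y => WeakDistributedExpansion
      ((BipartiteGraph.ofTrials x).tensor (BipartiteGraph.ofTrials y)) Ω δ (1 / 8)]
    exact lt_unifProb_weakDistributedExpansion (by simp [two_mul]) Sum.inl_injective
      Sum.inr_injective hC₁ hC hp hΩ hδ₁ hδ₂ hm
  · rw [trialLaw_real_eq]
    exact lt_unifProb_weakDistributedExpansion (f := id) (g := id) (by simp; omega)
      Function.injective_id Function.injective_id hC₁ hC hp hΩ hδ₁ hδ₂ hm
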